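/- **System.** A UAV hovers at altitude $h\ge 0$ above a point $O$ of the ground plane. Ground relays form a Poisson point process with constant density $\lambda\ge 0$ in the disk $\mathcal C$ of radius $r_{\mathcal C}\ge 0$ centred at $O$; $|\mathcal C|$ is its area. The destination D has polar coordinates $(r_D,\varphi_D)$ about $O$. Let $K$ (Rician factor, non-decreasing, $\kappa_0=K(0)\ge 0$) and $\alpha$ (path loss exponent, non-increasing, $\alpha_0=\alpha(0)$) be functions of the elevation angle in $[0,\pi/2]$, and let $A,P_U,P_R,N_0,\xi>0$. For a relay R at distance $r_R$ from $O$, with elevation angle $\theta_R=\arctan(h/r_R)$ and distances $\ell_{UR}=\sqrt{r_R^2+h^2}$ to the UAV and $\ell_{RD}$ to D, the received SNRs are $$\Gamma_{UR}=\frac{AP_U}{N_0\,\ell_{UR}^{\,\alpha(\theta_R)}}\,\Omega_{UR},\qquad \Gamma_{RD}=\frac{AP_R}{N_0\,\ell_{RD}^{\,\alpha_0}}\,\Omega_{RD}.$$ Conditionally on the relays' number and positions, all fading powers $\Omega$ are independent; $\Omega_{UR}$ is Rician with factor $K(\theta_R)$ and $\Omega_{RD}$ is Rician with factor $\kappa_0$,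 where a Rician fading power with factor $k$ (and unit mean) has density $(k+1)e^{-k}e^{-(k+1)w}I_0\big(2\sqrt{k(k+1)w}\big)$ for $w\ge 0$. Here $I_0$ is the modified Bessel function of the first kind of order zero. Put $\gamma_R=AP_R/N_0$, and let $Q(a,b)=\int_b^\infty x\,e^{-(x^2+a^2)/2}I_0(ax)\,dx$ be the first order Marcum Q-function. Let $\mathcal A$ be the set of relays with $\Gamma_{UR}>\xi$ (those that decode the UAV signal), and let the relaying outage probability $P_{\rm out}^{\rm rc}(r_D,h)$ be the probability that $\max_{R\in\mathcal A}\Gamma_{RD}\le\xi$, an empty $\mathcal A$ counting as an outage. **Statement.** For all $h\ge 0$, $r_D\ge 0$ and $\varphi_D$, $$P_{\rm out}^{\rm rc}(r_D,h)\;\ge\; e^{-\lambda\,[\,|\mathcal C|-\psi_{02}(r_D)\,]},$$ where $$\psi_{02}(r_D)=\int_0^{2\pi}\!\!\int_0^{r_{\mathcal C}} r_R\Big[1-Q\Big(\sqrt{2\kappa_0},\sqrt{2(\kappa_0+1)\,\xi\,\ell_{RD}^{\,\alpha_0}/\gamma_R}\Big)\Big]\,dr_R\,d\varphi_R,$$ $$\ell_{RD}=\sqrt{r_R^2+r_D^2-2r_Rr_D\cos(\varphi_R-\varphi_D)}.$$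 The factor in brackets is the probability that the link from a relay at $(r_R,\varphi_R)$ to D fails. The right-hand side, which does not involve $h$ (for a given disk $\mathcal C$), equals the outage probability when every relay decodes, that is, the probability that $\max_R\Gamma_{RD}\le\xi$ over all relays R in $\mathcal C$ (again with an outage if there is no relay). -/

import Mathlib

open MeasureTheory ProbabilityTheory
open scoped ENNReal

namespace UAVRelay

/-- The modified Bessel function of the first kind of order zero,
`I₀(x) = ∑ₖ (x/2)^(2k) / (k!)²`. -/
noncomputable def besselI0 (x : ℝ) : ℝ :=
  ∑' k : ℕ, (x / 2) ^ (2 * k) / (k.factorial : ℝ) ^ 2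

/-- The first order Marcum Q-function
`Q(a, b) = ∫_b^∞ x exp(-(x² + a²)/2) I₀(a x) dx`. -/
noncomputable def marcumQ (a b : ℝ) : ℝ :=
  ∫ x in Set.Ioi b, x * Real.exp (-(x ^ 2 + a ^ 2) / 2) * besselI0 (a * x)

/-- The density at `w ≥ 0` of the fading power of a Rician channel with Rician factor `K`
and unit mean power. -/
noncomputable def ricianPowerPDF (K w : ℝ) : ℝ :=
  (K + 1) * Real.exp (-K) * Real.exp (-((K + 1) * w)) *
    besselI0 (2 * Real.sqrt (K * (K + 1) * w))

/-- The law of the fading power of a Rician channel with factor `K` and unit mean power. -/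
noncomputable def ricianPowerLaw (K : ℝ) : Measure ℝ :=
  (volume.restrict (Set.Ici (0 : ℝ))).withDensity fun w => ENNReal.ofReal (ricianPowerPDF K w)

/-- The deterministic parameters of the system, with their standing assumptions. -/
structure System where
  /-- gain constant -/
  A : ℝ
  /-- transmit power of the UAV -/
  PU : ℝ
  /-- common transmit power of the relays -/
  PR : ℝ
  /-- noise power -/
  N0 : ℝ
  /-- SNR threshold -/
  xi : ℝ
  /-- density of the relays -/
  density : ℝ
  /-- radius of the disk in which the relays are placed -/
  rC : ℝ
  /-- Rician factor as a function of the elevation angle -/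
  K : ℝ → ℝ
  /-- path loss exponent as a function of the elevation angle -/
  alpha : ℝ → ℝ
  A_pos : 0 < A
  PU_pos : 0 < PU
  PR_pos : 0 < PR
  N0_pos : 0 < N0
  xi_pos : 0 < xi
  density_nonneg : 0 ≤ density
  rC_nonneg : 0 ≤ rC
  K_zero_nonneg : 0 ≤ K 0
  K_mono : MonotoneOn K (Set.Icc 0 (Real.pi / 2))
  alpha_anti : AntitoneOn alpha (Set.Icc 0 (Real.pi / 2))

/-- The elevation angle of a UAV of altitude `h` seen from a ground node at distance `r` from
the projection `O` of the UAV: `arctan (h / r)`, read as `π / 2` right below the UAV. -/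
noncomputable def elevation (h r : ℝ) : ℝ :=
  if r = 0 then Real.pi / 2 else Real.arctan (h / r)

/-- The ground point with polar coordinates `(r, φ)`. The ground plane is `ℂ`, with `O = 0`;
its norm is the Euclidean one and `volume` is the area. -/
noncomputable def groundPoint (r φ : ℝ) : ℂ :=
  (r : ℂ) * Complex.exp (Complex.I * φ)

namespace System

variable (S : System)

/-- The disk `𝒞` of the relays, centred at the projection of the UAV. -/
def disk : Set ℂ := Metric.closedBall 0 S.rC

/-- `γ_R = A P_R / N₀`. -/
noncomputable def gammaR : ℝ := S.A * S.PR / S.N0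

/-- SNR of the link from the UAV at altitude `h` to a ground node at `x`, for fading power
`w`. -/
noncomputable def snrUR (h : ℝ) (x : ℂ) (w : ℝ) : ℝ :=
  S.A * S.PU / (S.N0 * Real.sqrt (‖x‖ ^ 2 + h ^ 2) ^ S.alpha (elevation h ‖x‖)) * w

/-- SNR of the ground-to-ground link from a relay at `x` to a destination at `d`, for fading
power `w`. -/
noncomputable def snrRD (d x : ℂ) (w : ℝ) : ℝ :=
  S.A * S.PR / (S.N0 * dist x d ^ S.alpha 0) * w

/-- `ψ₀₁`, the area of the disk `𝒞`. -/
noncomputable def psi01 : ℝ := volume.real S.disk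

/-- `ψ₀₂`; the value does not depend on the polar angle `φD` of the destination. -/
noncomputable def psi02 (rD φD : ℝ) : ℝ :=
  ∫ φ in (0 : ℝ)..(2 * Real.pi), ∫ r in (0 : ℝ)..S.rC,
    r * (1 - marcumQ (Real.sqrt (2 * S.K 0))
      (Real.sqrt (2 * (S.K 0 + 1) * S.xi *
        Real.sqrt (r ^ 2 + rD ^ 2 - 2 * r * rD * Real.cos (φ - φD)) ^ S.alpha 0 / S.gammaR)))

end System

variable {Ω : Type*}

/-- The number of the points `X 0, …, X (N - 1)` that lie in `B`. -/
noncomputable def pointCount (N : Ω → ℕ) (X : ℕ → Ω → ℂ) (B : Set ℂ) (ω : Ω) : ℕ :=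
  by classical exact ((Finset.range (N ω)).filter fun j => X j ω ∈ B).card

/-- The random finite family of points `X 0, …, X (N - 1)` is a Poisson point process with
constant density `lam` in the region `C`: the number of points in a set is Poisson with mean
`lam` times the area of the part of the set in `C`, and the numbers of points in pairwise
disjoint sets are independent. The enumeration of the points is arbitrary. -/
structure IsPoissonPointProcess [MeasurableSpace Ω] (P : Measure Ω) (lam : ℝ) (C : Set ℂ)
    (N : Ω → ℕ) (X : ℕ → Ω → ℂ) : Prop where
  measurable_N : Measurable N
  measurable_X : ∀ j, Measurable (X j)
  count_law : ∀ B : Set ℂ, MeasurableSet B →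
    P.map (pointCount N X B) = poissonMeasure (lam * volume.real (B ∩ C)).toNNReal
  count_indep : ∀ (m : ℕ) (B : Fin m → Set ℂ), (∀ i, MeasurableSet (B i)) →
    Pairwise (fun i k => Disjoint (B i) (B k)) →
    iIndepFun (fun i => pointCount N X (B i)) P

/-- The random relays and fading powers of the system for a UAV of altitude `h`: the relays,
`N` of them at positions `X 0, …, X (N - 1)`, form a Poisson point process in the disk, and,
conditionally on their number and positions, the fading powers `WU j` (UAV to relay `j`) and
`WR j` (relay `j` to destination) are independent, Rician with factor `K(θ)` at the elevation
angle `θ` of the relay and with factor `κ₀ = K(0)`, respectively. -/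
structure IsRelayNetwork [MeasurableSpace Ω] (S : System) (h : ℝ) (P : Measure Ω)
    (N : Ω → ℕ) (X : ℕ → Ω → ℂ) (WU WR : ℕ → Ω → ℝ) : Prop where
  poisson : IsPoissonPointProcess P S.density S.disk N X
  measurable_WU : ∀ j, Measurable (WU j)
  measurable_WR : ∀ j, Measurable (WR j)
  fading : ∀ (n : ℕ) (f : ℕ → ℂ × ℝ × ℝ → ℝ≥0∞), (∀ j, Measurable (f j)) →
    ∫⁻ ω in {ω | N ω = n}, ∏ j ∈ Finset.range n, f j (X j ω, WU j ω, WR j ω) ∂P =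
      ∫⁻ ω in {ω | N ω = n}, ∏ j ∈ Finset.range n,
        (∫⁻ u, ∫⁻ v, f j (X j ω, u, v) ∂(ricianPowerLaw (S.K 0))
          ∂(ricianPowerLaw (S.K (elevation h ‖X j ω‖)))) ∂P

/-- The set `𝒜` of (indices of) relays that decode the signal of the UAV. -/
noncomputable def decodingSet (S : System) (h : ℝ) (N : Ω → ℕ) (X : ℕ → Ω → ℂ)
    (WU : ℕ → Ω → ℝ) (ω : Ω) : Finset ℕ :=
  (Finset.range (N ω)).filter fun j => S.xi < S.snrUR h (X j ω) (WU j ω)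

/-- The SNR at the destination `d` of the best relay among those in `s`; it is `⊥` if `s` is
empty, as nothing is then transmitted. -/
noncomputable def bestSNR (S : System) (d : ℂ) (X : ℕ → Ω → ℂ) (WR : ℕ → Ω → ℝ)
    (s : Finset ℕ) (ω : Ω) : EReal :=
  s.sup fun j => ((S.snrRD d (X j ω) (WR j ω) : ℝ) : EReal)

/-- The relaying outage probability: the probability that the SNR at the destination `d` of
the best relay among those that decode does not exceed the threshold. -/
noncomputable def relayingOutage [MeasurableSpace Ω] (S : System) (h : ℝ) (d : ℂ)
    (P : Measure Ω) (N : Ω → ℕ) (X : ℕ → Ω → ℂ) (WU WR : ℕ → Ω → ℝ) : ℝ :=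
  P.real {ω | bestSNR S d X WR (decodingSet S h N X WU ω) ω ≤ (S.xi : EReal)}

/-- The outage probability when every relay decodes the signal of the UAV. -/
noncomputable def allDecodeOutage [MeasurableSpace Ω] (S : System) (d : ℂ)
    (P : Measure Ω) (N : Ω → ℕ) (X : ℕ → Ω → ℂ) (WR : ℕ → Ω → ℝ) : ℝ :=
  P.real {ω | bestSNR S d X WR (Finset.range (N ω)) ω ≤ (S.xi : EReal)}

end UAVRelay

/-! ### Rician fading powers and the Marcum Q-function -/

namespace UAVRelay

/-! The inequality is monotonicity: the decoding relays are among all relays, so if every link to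
the destination fails then so does every link from a decoding relay
(`allDecodeOutage_le_relayingOutage`).

The substance is the closed form for the outage when all relays decode. Given the positions, the
fadings are independent, so the conditional probability is the product over the relays of the link
failure probability `q(x)` (`linkOutage`). The UAV fading integrates to one, which removes `h`. The
generating functional of the Poisson process (`IsPoissonPointProcess.integral_prod`) then gives `E ∏
q(X j) = exp (-λ ∫ (1 - q))` over the disk. Finally `q` is a Rician distribution function, which is
one minus a Marcum Q (`ricianPowerLaw_real_Iic`), and polar coordinates identify `∫ q` with `ψ₀₂`
(`psi02_eq`). -/

lemma besselI0_eq (x : ℝ) :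
    besselI0 x = ∑' k : ℕ, ((x / 2) ^ 2) ^ k / (k.factorial : ℝ) ^ 2 := by
  simp only [besselI0, pow_mul]

lemma summable_pow_div_factorial_sq {y : ℝ} (hy : 0 ≤ y) :
    Summable fun k : ℕ => y ^ k / (k.factorial : ℝ) ^ 2 := by
  refine (Real.summable_pow_div_factorial y).of_nonneg_of_le (fun k => by positivity) fun k => ?_
  have h1 : (1 : ℝ) ≤ k.factorial := by exact_mod_cast k.factorial_pos
  gcongr
  nlinarith

lemma besselI0_nonneg (x : ℝ) : 0 ≤ besselI0 x := by
  rw [besselI0_eq]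
  exact tsum_nonneg fun k => by positivity

lemma measurable_besselI0 : Measurable besselI0 := by
  have h : Filter.Tendsto
      (fun n : ℕ => fun x : ℝ => ∑ k ∈ Finset.range n, ((x / 2) ^ 2) ^ k / (k.factorial : ℝ) ^ 2)
      Filter.atTop (nhds besselI0) := by
    rw [tendsto_pi_nhds]
    intro x
    rw [besselI0_eq]
    exact (summable_pow_div_factorial_sq (sq_nonneg _)).hasSum.tendsto_sum_nat
  refine measurable_of_tendsto_metrizable (fun n => ?_) h
  fun_prop

/-- A Rician power density is a Poisson mixture of gamma densities. -/
lemma ofReal_ricianPowerPDF {K w : ℝ} (hK : 0 ≤ K) (hw : 0 ≤ w) :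
    ENNReal.ofReal (ricianPowerPDF K w) =
      ∑' n : ℕ, ENNReal.ofReal (Real.exp (-K) * K ^ n / n.factorial) *
        gammaPDF ((n : ℝ) + 1) (K + 1) w := by
  have hy : 0 ≤ K * (K + 1) * w := by positivity
  have hs : besselI0 (2 * Real.sqrt (K * (K + 1) * w)) =
      ∑' k : ℕ, (K * (K + 1) * w) ^ k / (k.factorial : ℝ) ^ 2 := by
    rw [besselI0_eq]
    simp [mul_div_cancel_left₀, Real.sq_sqrt hy]
  rw [ricianPowerPDF, hs, ← tsum_mul_left, ENNReal.ofReal_tsum_of_nonneg (fun n => by positivity)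
    ((summable_pow_div_factorial_sq hy).mul_left _)]
  refine tsum_congr fun n => ?_
  rw [gammaPDF_of_nonneg hw, ← ENNReal.ofReal_mul (by positivity), Real.Gamma_nat_eq_factorial]
  congr 1
  rw [add_sub_cancel_right, Real.rpow_natCast, Real.rpow_add_one (by positivity),
    Real.rpow_natCast, mul_pow, mul_pow]
  field_simp

/-- In the mixture each gamma density has integral one, and the Poisson weights of mean `K` sum to
one. -/
lemma isProbabilityMeasure_ricianPowerLaw {K : ℝ} (hK : 0 ≤ K) :
    IsProbabilityMeasure (ricianPowerLaw K) := by
  constructor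
  have hmix : ∀ n : ℕ, ∫⁻ w in Set.Ici (0 : ℝ), gammaPDF ((n : ℝ) + 1) (K + 1) w = 1 := by
    intro n
    rw [← lintegral_gammaPDF_eq_one (a := (n : ℝ) + 1) (r := K + 1) (by positivity)
      (by positivity)]
    refine setLIntegral_eq_of_support_subset fun w hw => ?_
    by_contra hneg
    exact hw (gammaPDF_of_neg (not_le.mp hneg))
  have hm : ∀ n : ℕ, Measurable (gammaPDF ((n : ℝ) + 1) (K + 1)) := fun n =>
    (measurable_gammaPDFReal _ _).ennreal_ofReal
  rw [ricianPowerLaw, withDensity_apply _ MeasurableSet.univ, Measure.restrict_univ,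
    setLIntegral_congr_fun measurableSet_Ici fun w hw => ofReal_ricianPowerPDF hK hw,
    lintegral_tsum fun n => ((hm n).const_mul _).aemeasurable]
  simp_rw [lintegral_const_mul _ (hm _), hmix, mul_one]
  have hp : HasSum (fun n : ℕ => Real.exp (-K) * K ^ n / n.factorial) 1 :=
    hasSum_one_poissonMeasure ⟨K, hK⟩
  rw [← ENNReal.ofReal_tsum_of_nonneg (fun n => by positivity) hp.summable, hp.tsum_eq,
    ENNReal.ofReal_one]

lemma image_sq_div_Ioi {c b : ℝ} (hc : 0 < c) (hb : 0 ≤ b) :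
    (fun x : ℝ => x ^ 2 / c) '' Set.Ioi b = Set.Ioi (b ^ 2 / c) := by
  ext y
  simp only [Set.mem_image, Set.mem_Ioi]
  constructor
  · rintro ⟨x, hx, rfl⟩
    gcongr
  · intro hy
    have hcy : b ^ 2 < y * c := (div_lt_iff₀ hc).mp hy
    refine ⟨Real.sqrt (y * c), Real.lt_sqrt_of_sq_lt hcy, ?_⟩
    rw [Real.sq_sqrt ((sq_nonneg b).trans hcy.le), mul_div_cancel_right₀ _ hc.ne']

/-- Substitute `w = x² / (2(K + 1))`, which is injective on `x > b` because `b ≥ 0`. -/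
lemma marcumQ_eq {K b : ℝ} (hK : 0 ≤ K) (hb : 0 ≤ b) :
    marcumQ (Real.sqrt (2 * K)) b =
      (ricianPowerLaw K).real (Set.Ioi (b ^ 2 / (2 * (K + 1)))) := by
  have hc : 0 < 2 * (K + 1) := by positivity
  have hsub : Set.Ioi (b ^ 2 / (2 * (K + 1))) ⊆ Set.Ici 0 := fun x hx =>
    le_trans (by positivity : (0 : ℝ) ≤ b ^ 2 / (2 * (K + 1))) (le_of_lt hx)
  rw [marcumQ, integral_eq_lintegral_of_nonneg_ae, measureReal_def, ricianPowerLaw,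
    withDensity_apply _ measurableSet_Ioi, Measure.restrict_restrict measurableSet_Ioi,
    Set.inter_eq_left.mpr hsub, ← image_sq_div_Ioi hc hb,
    lintegral_image_eq_lintegral_abs_deriv_mul (f' := fun x => 2 * x / (2 * (K + 1)))
      measurableSet_Ioi]
  · congr 1
    refine setLIntegral_congr_fun measurableSet_Ioi fun x (hx : b < x) => ?_
    have hx0 : 0 < x := hb.trans_lt hx
    have harg : 2 * Real.sqrt (K * (K + 1) * (x ^ 2 / (2 * (K + 1)))) =
        Real.sqrt (2 * K) * x := by
      have : K * (K + 1) * (x ^ 2 / (2 * (K + 1))) = (2 * K) * (x / 2) ^ 2 := by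
        field_simp
      rw [this, Real.sqrt_mul (by positivity), Real.sqrt_sq (by positivity)]
      ring
    have hexp : Real.exp (-(x ^ 2 + Real.sqrt (2 * K) ^ 2) / 2) =
        Real.exp (-K) * Real.exp (-((K + 1) * (x ^ 2 / (2 * (K + 1))))) := by
      rw [← Real.exp_add, Real.sq_sqrt (by positivity)]
      congr 1
      field_simp
      ring
    rw [← ENNReal.ofReal_mul (abs_nonneg _), abs_of_nonneg (by positivity), ricianPowerPDF, harg,
      hexp]
    congr 1
    field_simp
  · intro x _
    have := (hasDerivAt_pow 2 x).div_const (2 * (K + 1))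
    simpa using this.hasDerivWithinAt
  · intro x hx y hy hxy
    have hx0 : 0 ≤ x := hb.trans (le_of_lt hx)
    have hy0 : 0 ≤ y := hb.trans (le_of_lt hy)
    simp only at hxy
    rw [div_left_inj' hc.ne'] at hxy
    exact (pow_left_inj₀ hx0 hy0 two_ne_zero).mp hxy
  · filter_upwards [ae_restrict_mem measurableSet_Ioi] with x hx
    have hx0 : 0 ≤ x := hb.trans (le_of_lt hx)
    have := besselI0_nonneg (Real.sqrt (2 * K) * x)
    simp only [Pi.zero_apply]
    positivity
  · have := measurable_besselI0
    exact Measurable.aestronglyMeasurable (by fun_prop)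

/-- The distribution function of a Rician fading power in terms of the Marcum Q-function. -/
lemma ricianPowerLaw_real_Iic {K t : ℝ} (hK : 0 ≤ K) (ht : 0 ≤ t) :
    (ricianPowerLaw K).real (Set.Iic t) =
      1 - marcumQ (Real.sqrt (2 * K)) (Real.sqrt (2 * (K + 1) * t)) := by
  have := isProbabilityMeasure_ricianPowerLaw hK
  have h2 : 2 * (K + 1) * t / (2 * (K + 1)) = t := by field_simp
  rw [marcumQ_eq hK (Real.sqrt_nonneg _), Real.sq_sqrt (by positivity), h2,
    ← Set.compl_Iic, probReal_compl_eq_one_sub measurableSet_Iic]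
  ring

end UAVRelay

/-! ### The generating functional of a Poisson point process -/

namespace UAVRelay

/-- The probability generating function of a Poisson distribution. -/
lemma integral_pow_poissonMeasure (m : NNReal) (c : ℝ) :
    ∫ n, c ^ n ∂(poissonMeasure m) = Real.exp (-(m * (1 - c))) := by
  rw [integral_poissonMeasure]
  have h : ∀ n : ℕ, (Real.exp (-m) * (m : ℝ) ^ n / n.factorial) • c ^ n =
      Real.exp (-m) * ((m * c) ^ n / n.factorial) := by
    intro n
    rw [smul_eq_mul, mul_pow]
    ring
  simp_rw [h]
  rw [tsum_mul_left, ← congrFun (NormedSpace.exp_eq_tsum_div (𝔸 := ℝ)) (m * c),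
    ← Real.exp_eq_exp_ℝ, ← Real.exp_add]
  ring_nf

variable {Ω : Type*} {N : Ω → ℕ} {X : ℕ → Ω → ℂ}

/-- Group the points by the value of `s` at them. The values are indexed by `Fin` to match the form
of `count_indep`. -/
lemma prod_apply_eq_prod_pow_pointCount (s : SimpleFunc ℂ ℝ) (ω : Ω) :
    ∏ j ∈ Finset.range (N ω), s (X j ω) =
      ∏ i : Fin s.range.card,
        ((s.range.equivFin.symm i : ℝ)) ^
          pointCount N X (s ⁻¹' {(s.range.equivFin.symm i : ℝ)}) ω := by
  classical
  rw [Equiv.prod_comp s.range.equivFin.symm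
      (fun c : s.range => (c : ℝ) ^ pointCount N X (s ⁻¹' {(c : ℝ)}) ω),
    Finset.prod_coe_sort s.range (fun c : ℝ => c ^ pointCount N X (s ⁻¹' {c}) ω),
    ← Finset.prod_fiberwise_of_maps_to (t := s.range) (g := fun j => s (X j ω))
      fun j _ => s.mem_range_self _]
  refine Finset.prod_congr rfl fun c _ => ?_
  rw [Finset.prod_congr rfl fun j hj => (Finset.mem_filter.mp hj).2, Finset.prod_const]
  congr 2

variable [MeasurableSpace Ω] {P : Measure Ω} {lam : ℝ} {C : Set ℂ}

lemma measurable_prod_range {M : Type*} [CommMonoid M] [MeasurableSpace M] [MeasurableMul₂ M]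
    (hN : Measurable N) {g : ℕ → Ω → M} (hg : ∀ j, Measurable (g j)) :
    Measurable fun ω => ∏ j ∈ Finset.range (N ω), g j ω := by
  have h1 : Measurable fun p : ℕ × Ω => ∏ j ∈ Finset.range p.1, g j p.2 :=
    measurable_from_prod_countable_right fun k =>
      Finset.measurable_fun_prod (Finset.range k) fun j _ => hg j
  have h2 : Measurable fun ω => (N ω, ω) := hN.prodMk measurable_id
  exact Measurable.comp (f := fun ω => (N ω, ω)) h1 h2

/-- The fibres of `s` are disjoint, so their counts are independent and the expectation factors into
Poisson generating functions, whose exponents add up to the integral of `1 - s`. -/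
lemma IsPoissonPointProcess.integral_prod_simpleFunc [IsProbabilityMeasure P]
    (hP : IsPoissonPointProcess P lam C N X) (hlam : 0 ≤ lam) (hC : volume C ≠ ∞)
    (s : SimpleFunc ℂ ℝ) :
    ∫ ω, ∏ j ∈ Finset.range (N ω), s (X j ω) ∂P =
      Real.exp (-(lam * ∫ x in C, (1 - s x))) := by
  set e := s.range.equivFin.symm
  have hmeas : ∀ i, MeasurableSet (s ⁻¹' {(e i : ℝ)}) := fun i => s.measurableSet_fiber _
  -- Measurability of the counts follows from their law: the pushforward along a map that is not
  -- a.e. measurable would be zero.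
  have hcount : ∀ i, AEMeasurable (pointCount N X (s ⁻¹' {(e i : ℝ)})) P := fun i =>
    aemeasurable_of_map_neZero (by rw [hP.count_law _ (hmeas i)]; infer_instance)
  have hind := hP.count_indep _ (fun i => s ⁻¹' {(e i : ℝ)}) hmeas fun i k hik =>
    Disjoint.preimage _ (Set.disjoint_singleton.mpr fun h => hik (e.injective (Subtype.ext h)))
  have : IsFiniteMeasure (volume.restrict C) := ⟨by simpa using hC.lt_top⟩
  simp_rw [prod_apply_eq_prod_pow_pointCount]
  rw [hind.integral_fun_prod_comp (f := fun i n => (e i : ℝ) ^ n) hcount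
    fun i => (measurable_of_countable _).aestronglyMeasurable]
  have hone : ∀ i, ∫ ω, (e i : ℝ) ^ pointCount N X (s ⁻¹' {(e i : ℝ)}) ω ∂P =
      Real.exp (-(lam * (volume.real (s ⁻¹' {(e i : ℝ)} ∩ C) * (1 - e i)))) := by
    intro i
    rw [← integral_map (f := fun n : ℕ => (e i : ℝ) ^ n) (hcount i)
      (measurable_of_countable _).aestronglyMeasurable, hP.count_law _ (hmeas i),
      integral_pow_poissonMeasure, Real.coe_toNNReal _ (by positivity), mul_assoc]
  rw [Finset.prod_congr rfl fun i _ => hone i, ← Real.exp_sum, Finset.sum_neg_distrib,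
    ← Finset.mul_sum, Equiv.sum_comp e (fun c : s.range =>
      volume.real (s ⁻¹' {(c : ℝ)} ∩ C) * (1 - (c : ℝ))),
    Finset.sum_coe_sort s.range (fun c : ℝ => volume.real (s ⁻¹' {c} ∩ C) * (1 - c))]
  have hs : Integrable s (volume.restrict C) := s.integrable_of_isFiniteMeasure
  rw [integral_sub (integrable_const _) hs]
  have h1 : ∫ _ in C, (1 : ℝ) = ∑ c ∈ s.range, volume.real (s ⁻¹' {c} ∩ C) := by
    have := (SimpleFunc.const ℂ (1 : ℝ)).integral_eq_integral (μ := volume.restrict C)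
    rw [setIntegral_const, smul_eq_mul, mul_one]
    have hr := sum_measureReal_preimage_singleton (μ := volume.restrict C) s.range (f := s)
      (fun y _ => s.measurableSet_fiber y)
    simp only [measureReal_restrict_apply (s.measurableSet_fiber _)] at hr
    rw [hr, measureReal_restrict_apply (s.measurableSet_preimage _)]
    congr 1
    ext x
    simp
  have h2 : ∫ x in C, s x = ∑ c ∈ s.range, volume.real (s ⁻¹' {c} ∩ C) * c := by
    rw [← s.integral_eq_integral hs, s.integral_eq]
    refine Finset.sum_congr rfl fun c _ => ?_
    rw [measureReal_restrict_apply (s.measurableSet_fiber _), smul_eq_mul]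
  rw [h1, h2, ← Finset.sum_sub_distrib]
  simp_rw [mul_sub, mul_one]

/-- The probability generating functional of a Poisson point process. -/
lemma IsPoissonPointProcess.integral_prod [IsProbabilityMeasure P]
    (hP : IsPoissonPointProcess P lam C N X) (hlam : 0 ≤ lam) (hC : volume C ≠ ∞)
    {g : ℂ → ℝ≥0∞} (hg : Measurable g) (hg1 : ∀ x, g x ≤ 1) :
    ∫ ω, ∏ j ∈ Finset.range (N ω), (g (X j ω)).toReal ∂P =
      Real.exp (-(lam * ∫ x in C, (1 - (g x).toReal))) := by
  -- Approximate `g` from below by simple functions; all values lie in `[0, 1]`, so dominated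
  -- convergence with bound 1 applies on both sides.
  let s : ℕ → SimpleFunc ℂ ℝ := fun n => (SimpleFunc.eapprox g n).map ENNReal.toReal
  have hle : ∀ n x, SimpleFunc.eapprox g n x ≤ 1 := fun n x =>
    (Monotone.ge_of_tendsto (fun _ _ hmn => SimpleFunc.monotone_eapprox g hmn x)
      (SimpleFunc.tendsto_eapprox hg x) n).trans (hg1 x)
  have hs0 : ∀ n x, 0 ≤ s n x := fun n x => ENNReal.toReal_nonneg
  have hs1 : ∀ n x, s n x ≤ 1 := fun n x =>
    ENNReal.toReal_one ▸ ENNReal.toReal_mono ENNReal.one_ne_top (hle n x)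
  have hlim : ∀ x, Filter.Tendsto (fun n => s n x) Filter.atTop (nhds (g x).toReal) := fun x =>
    (ENNReal.tendsto_toReal ((hg1 x).trans_lt ENNReal.one_lt_top).ne).comp
      (SimpleFunc.tendsto_eapprox hg x)
  have : IsFiniteMeasure (volume.restrict C) := ⟨by simpa using hC.lt_top⟩
  have hprod : ∀ n, Measurable fun ω => ∏ j ∈ Finset.range (N ω), s n (X j ω) := fun n =>
    measurable_prod_range hP.measurable_N fun j => (s n).measurable.comp (hP.measurable_X j)
  have hL : Filter.Tendsto (fun n => ∫ ω, ∏ j ∈ Finset.range (N ω), s n (X j ω) ∂P) Filter.atTop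
      (nhds (∫ ω, ∏ j ∈ Finset.range (N ω), (g (X j ω)).toReal ∂P)) := by
    refine tendsto_integral_of_dominated_convergence (fun _ => 1)
      (fun n => (hprod n).aestronglyMeasurable) (integrable_const _) (fun n => ?_) ?_
    · refine Filter.Eventually.of_forall fun ω => ?_
      rw [Real.norm_of_nonneg (Finset.prod_nonneg fun j _ => hs0 n _)]
      exact Finset.prod_le_one (fun j _ => hs0 n _) fun j _ => hs1 n _
    · exact Filter.Eventually.of_forall fun ω => tendsto_finsetProd _ fun j _ => hlim _
  have hR : Filter.Tendsto (fun n => ∫ x in C, (1 - s n x)) Filter.atTop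
      (nhds (∫ x in C, (1 - (g x).toReal))) := by
    refine tendsto_integral_of_dominated_convergence (fun _ => 1)
      (fun n => (measurable_const.sub (s n).measurable).aestronglyMeasurable)
      (integrable_const _) (fun n => ?_) ?_
    · refine Filter.Eventually.of_forall fun x => ?_
      rw [Real.norm_of_nonneg (sub_nonneg.mpr (hs1 n x))]
      exact sub_le_self _ (hs0 n x)
    · exact Filter.Eventually.of_forall fun x => (hlim x).const_sub 1
  simp_rw [hP.integral_prod_simpleFunc hlam hC] at hL
  exact tendsto_nhds_unique hL
    ((Real.continuous_exp.tendsto _).comp (hR.const_mul lam).neg)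

end UAVRelay

/-! ### Polar coordinates on the disk -/

namespace UAVRelay

lemma norm_groundPoint {r : ℝ} (hr : 0 ≤ r) (φ : ℝ) : ‖groundPoint r φ‖ = r := by
  rw [groundPoint, norm_mul, Complex.norm_real, Real.norm_of_nonneg hr, mul_comm Complex.I,
    Complex.norm_exp_ofReal_mul_I, mul_one]

lemma measurable_groundPoint : Measurable fun p : ℝ × ℝ => groundPoint p.1 p.2 := by
  unfold groundPoint
  fun_prop

lemma periodic_groundPoint (r : ℝ) : Function.Periodic (groundPoint r) (2 * Real.pi) := by
  intro φ
  simp only [groundPoint]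
  push_cast
  rw [mul_add, mul_comm Complex.I (2 * (Real.pi : ℂ)), Complex.exp_add, Complex.exp_two_pi_mul_I,
    mul_one]

lemma polarCoord_symm_eq_groundPoint (p : ℝ × ℝ) :
    Complex.polarCoord.symm p = groundPoint p.1 p.2 := by
  rw [Complex.polarCoord_symm_apply, groundPoint, mul_comm Complex.I, Complex.exp_mul_I]
  push_cast
  rfl

/-- The law of cosines. -/
lemma dist_groundPoint (r φ s ψ : ℝ) :
    dist (groundPoint r φ) (groundPoint s ψ) =
      Real.sqrt (r ^ 2 + s ^ 2 - 2 * r * s * Real.cos (φ - ψ)) := by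
  rw [Complex.dist_eq, Complex.norm_def]
  congr 1
  have h : ∀ a b : ℝ, groundPoint a b = ⟨a * Real.cos b, a * Real.sin b⟩ := by
    intro a b
    rw [groundPoint, mul_comm Complex.I, Complex.exp_mul_I, ← Complex.ofReal_cos,
      ← Complex.ofReal_sin]
    apply Complex.ext <;> simp [-Complex.ofReal_cos, -Complex.ofReal_sin]
  rw [h, h, Complex.normSq_apply, Real.cos_sub]
  simp only [Complex.sub_re, Complex.sub_im]
  linear_combination r ^ 2 * Real.cos_sq_add_sin_sq φ + s ^ 2 * Real.cos_sq_add_sin_sq ψ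

/-- Integration over a disk in polar coordinates. -/
lemma setIntegral_closedBall_eq_polar {f : ℂ → ℝ} (hf : Measurable f) {M : ℝ}
    (hM : ∀ x, ‖f x‖ ≤ M) {R : ℝ} (hR : 0 ≤ R) :
    ∫ x in Metric.closedBall (0 : ℂ) R, f x =
      ∫ φ in (0 : ℝ)..(2 * Real.pi), ∫ r in (0 : ℝ)..R, r * f (groundPoint r φ) := by
  have hM0 : 0 ≤ M := (norm_nonneg _).trans (hM 0)
  rw [← integral_indicator Metric.isClosed_closedBall.measurableSet,
    ← Complex.integral_comp_polarCoord_symm, polarCoord_target]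
  have h1 : ∫ p in Set.Ioi (0 : ℝ) ×ˢ Set.Ioo (-Real.pi) Real.pi,
        p.1 • (Metric.closedBall (0 : ℂ) R).indicator f (Complex.polarCoord.symm p) =
      ∫ p in Set.Ioc (0 : ℝ) R ×ˢ Set.Ioo (-Real.pi) Real.pi, p.1 * f (groundPoint p.1 p.2) := by
    rw [← integral_indicator (measurableSet_Ioi.prod measurableSet_Ioo),
      ← integral_indicator (measurableSet_Ioc.prod measurableSet_Ioo)]
    congr 1
    ext p
    by_cases hp : p ∈ Set.Ioi (0 : ℝ) ×ˢ Set.Ioo (-Real.pi) Real.pi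
    · have hp0 : 0 < p.1 := hp.1
      rw [Set.indicator_of_mem hp, polarCoord_symm_eq_groundPoint]
      by_cases hpR : p.1 ≤ R
      · rw [Set.indicator_of_mem (by simpa [norm_groundPoint hp0.le] using hpR),
          Set.indicator_of_mem (show p ∈ Set.Ioc (0 : ℝ) R ×ˢ _ from ⟨⟨hp0, hpR⟩, hp.2⟩), smul_eq_mul]
      · rw [Set.indicator_of_notMem (by simpa [norm_groundPoint hp0.le] using hpR),
          Set.indicator_of_notMem fun h => hpR h.1.2, smul_zero]
    · rw [Set.indicator_of_notMem hp, Set.indicator_of_notMem fun h => hp ⟨h.1.1, h.2⟩]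
  have hint : IntegrableOn (fun p : ℝ × ℝ => p.2 * f (groundPoint p.2 p.1))
      (Set.Ioo (-Real.pi) Real.pi ×ˢ Set.Ioc (0 : ℝ) R) (volume.prod volume) := by
    refine Measure.integrableOn_of_bounded (M := R * M) ?_ ?_ ?_
    · rw [Measure.prod_prod]
      simp [ENNReal.mul_eq_top]
    · have := hf.comp (measurable_groundPoint.comp measurable_swap)
      exact (measurable_snd.mul this).aestronglyMeasurable
    · filter_upwards [ae_restrict_mem (measurableSet_Ioo.prod measurableSet_Ioc)] with p hp
      rw [norm_mul, Real.norm_of_nonneg hp.2.1.le]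
      exact mul_le_mul hp.2.2 (hM _) (norm_nonneg _) hR
  -- `Complex.polarCoord` takes angles in `(-π, π)`; periodicity moves the integral to `[0, 2π]`.
  have hper : Function.Periodic
      (fun φ => ∫ r in (0 : ℝ)..R, r * f (groundPoint r φ)) (2 * Real.pi) := fun φ => by
    simp only [periodic_groundPoint _ φ]
  rw [h1, Measure.volume_eq_prod, ← setIntegral_prod_swap]
  simp only [Prod.fst_swap, Prod.snd_swap]
  rw [setIntegral_prod _ hint, ← zero_add (2 * Real.pi),
    hper.intervalIntegral_add_eq 0 (-Real.pi),
    intervalIntegral.integral_of_le (by linarith [Real.pi_pos]), integral_Ioc_eq_integral_Ioo,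
    show -Real.pi + 2 * Real.pi = Real.pi by ring]
  simp_rw [intervalIntegral.integral_of_le hR]

lemma elevation_mem_Icc {h r : ℝ} (hh : 0 ≤ h) (hr : 0 ≤ r) :
    elevation h r ∈ Set.Icc 0 (Real.pi / 2) := by
  unfold elevation
  split_ifs
  · exact ⟨by positivity, le_rfl⟩
  · exact ⟨Real.arctan_nonneg.mpr (by positivity), (Real.arctan_lt_pi_div_two _).le⟩

/-! ### The failure probability of a single link -/

namespace System

variable (S : System)

lemma gammaR_pos : 0 < S.gammaR := div_pos (mul_pos S.A_pos S.PR_pos) S.N0_pos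

lemma K_elevation_nonneg {h r : ℝ} (hh : 0 ≤ h) (hr : 0 ≤ r) : 0 ≤ S.K (elevation h r) := by
  have he := elevation_mem_Icc hh hr
  exact S.K_zero_nonneg.trans (S.K_mono ⟨le_rfl, by positivity⟩ he he.1)

lemma measurable_snrRD (d : ℂ) : Measurable fun p : ℂ × ℝ => S.snrRD d p.1 p.2 := by
  unfold snrRD
  fun_prop

/-- The probability that the link from a relay at `x` to the destination `d` fails. -/
noncomputable def linkOutage (d x : ℂ) : ℝ≥0∞ :=
  ricianPowerLaw (S.K 0) {v | S.snrRD d x v ≤ S.xi}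

lemma linkOutage_le_one (d x : ℂ) : S.linkOutage d x ≤ 1 := by
  have := isProbabilityMeasure_ricianPowerLaw S.K_zero_nonneg
  exact prob_le_one

lemma measurable_linkOutage (d : ℂ) : Measurable (S.linkOutage d) := by
  have := isProbabilityMeasure_ricianPowerLaw S.K_zero_nonneg
  exact measurable_measure_prodMk_left (measurableSet_le (S.measurable_snrRD d) measurable_const)

/-- The indicator function of the failure of the link to `d` from a relay, as a function of the
position of the relay and of its two fading powers. -/
noncomputable def linkFailure (d : ℂ) : ℂ × ℝ × ℝ → ℝ≥0∞ :=
  {p | S.snrRD d p.1 p.2.2 ≤ S.xi}.indicator 1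

lemma measurable_linkFailure (d : ℂ) : Measurable (S.linkFailure d) := by
  have hm : Measurable fun p : ℂ × ℝ × ℝ => S.snrRD d p.1 p.2.2 := by
    unfold snrRD
    fun_prop
  exact measurable_one.indicator (measurableSet_le hm measurable_const)

/-- Failure of the link to `d` does not depend on the UAV fading `u`, whose law has mass one. This
is where `h` drops out. -/
lemma lintegral_linkFailure {h : ℝ} (hh : 0 ≤ h) (d x : ℂ) :
    ∫⁻ u, ∫⁻ v, S.linkFailure d (x, u, v) ∂(ricianPowerLaw (S.K 0))
      ∂(ricianPowerLaw (S.K (elevation h ‖x‖))) = S.linkOutage d x := by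
  have := isProbabilityMeasure_ricianPowerLaw (S.K_elevation_nonneg hh (norm_nonneg x))
  have hm : Measurable fun v : ℝ => S.snrRD d x v := by
    unfold snrRD
    fun_prop
  have hv : ∀ u : ℝ, ∫⁻ v, S.linkFailure d (x, u, v) ∂(ricianPowerLaw (S.K 0)) =
      S.linkOutage d x := fun u =>
    lintegral_indicator_one (measurableSet_le hm measurable_const)
  simp [hv]

/-- The threshold on the SNR becomes a threshold on the fading power. The point `x = d` is excluded:
if `α₀ ≠ 0`, division by zero makes the SNR there 0 and the left side 1, whereas the right side is
0. -/
lemma linkOutage_toReal {d x : ℂ} (hx : x ≠ d) :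
    (S.linkOutage d x).toReal =
      1 - marcumQ (Real.sqrt (2 * S.K 0))
        (Real.sqrt (2 * (S.K 0 + 1) * S.xi * dist x d ^ S.alpha 0 / S.gammaR)) := by
  have hl : 0 < dist x d ^ S.alpha 0 := Real.rpow_pos_of_pos (dist_pos.mpr hx) _
  have hγ := S.gammaR_pos
  have hset : {v | S.snrRD d x v ≤ S.xi} =
      Set.Iic (S.xi * dist x d ^ S.alpha 0 / S.gammaR) := by
    ext v
    have h : S.snrRD d x v = S.gammaR * v / dist x d ^ S.alpha 0 := by
      rw [snrRD, gammaR, div_mul_eq_div_div]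
      ring
    rw [Set.mem_ofPred_eq, Set.mem_Iic, h, div_le_iff₀ hl, le_div_iff₀ hγ, mul_comm v]
  have hxi := S.xi_pos
  rw [linkOutage, hset, ← measureReal_def, ricianPowerLaw_real_Iic S.K_zero_nonneg (by positivity)]
  congr 3
  ring

lemma psi02_eq (rD φD : ℝ) :
    S.psi02 rD φD = ∫ x in S.disk, (S.linkOutage (groundPoint rD φD) x).toReal := by
  set d := groundPoint rD φD with hd
  let F : ℂ → ℝ := fun x => 1 - marcumQ (Real.sqrt (2 * S.K 0))
        (Real.sqrt (2 * (S.K 0 + 1) * S.xi * dist x d ^ S.alpha 0 / S.gammaR))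
  -- `F` inherits measurability and boundedness from `linkOutage`, from which it can differ only at
  -- the single point `d`, a null set.
  have hF : F = fun x => if x = d then F d else (S.linkOutage d x).toReal := by
    ext x
    split_ifs with hx
    · rw [hx]
    · exact (S.linkOutage_toReal hx).symm
  have hFm : Measurable F := hF ▸ Measurable.ite (measurableSet_singleton d) measurable_const
    (S.measurable_linkOutage d).ennreal_toReal
  have hFM : ∀ x, ‖F x‖ ≤ max 1 ‖F d‖ := by
    intro x
    by_cases hx : x = d
    · exact hx ▸ le_max_right _ _
    · refine le_max_of_le_left ?_
      rw [show F x = _ from (S.linkOutage_toReal hx).symm, Real.norm_of_nonneg ENNReal.toReal_nonneg]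
      exact ENNReal.toReal_one ▸ ENNReal.toReal_mono ENNReal.one_ne_top (S.linkOutage_le_one d x)
  have hae : ∀ᵐ x ∂(volume.restrict S.disk), (S.linkOutage d x).toReal = F x := by
    filter_upwards [ae_restrict_of_ae (Measure.ae_ne volume d)] with x hx
    exact S.linkOutage_toReal hx
  rw [integral_congr_ae hae, disk, setIntegral_closedBall_eq_polar hFm hFM S.rC_nonneg, psi02]
  simp only [F, hd, dist_groundPoint]

end System

/-! ### Outage probabilities of the network -/

variable {Ω : Type*}

lemma bestSNR_le_iff {S : System} {d : ℂ} {X : ℕ → Ω → ℂ} {WR : ℕ → Ω → ℝ} {s : Finset ℕ}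
    {ω : Ω} {t : ℝ} :
    bestSNR S d X WR s ω ≤ (t : EReal) ↔ ∀ j ∈ s, S.snrRD d (X j ω) (WR j ω) ≤ t := by
  simp [bestSNR, Finset.sup_le_iff, EReal.coe_le_coe_iff]

/-- Writes the outage event as a product over the relays, the form to which `fading` applies. -/
lemma prod_linkFailure_eq_indicator (S : System) (d : ℂ) (N : Ω → ℕ) (X : ℕ → Ω → ℂ)
    (WU WR : ℕ → Ω → ℝ) (ω : Ω) :
    ∏ j ∈ Finset.range (N ω), S.linkFailure d (X j ω, WU j ω, WR j ω) =
      {ω | bestSNR S d X WR (Finset.range (N ω)) ω ≤ (S.xi : EReal)}.indicator 1 ω := by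
  classical
  simp only [System.linkFailure, Set.indicator_apply, Set.mem_ofPred_eq, bestSNR_le_iff,
    Pi.one_apply]
  rw [Finset.prod_ite_zero]
  simp

variable [MeasurableSpace Ω] {P : Measure Ω} {S : System} {h : ℝ} {N : Ω → ℕ} {X : ℕ → Ω → ℂ}
  {WU WR : ℕ → Ω → ℝ}

/-- Relays that do not decode can only increase the outage probability. -/
lemma allDecodeOutage_le_relayingOutage [IsFiniteMeasure P] (d : ℂ) :
    allDecodeOutage S d P N X WR ≤ relayingOutage S h d P N X WU WR := by
  refine measureReal_mono fun ω hω => ?_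
  rw [Set.mem_ofPred_eq, bestSNR_le_iff] at hω ⊢
  exact fun j hj => hω j (Finset.mem_filter.mp hj).1

lemma lintegral_eq_tsum_fiber (hN : Measurable N) (F : Ω → ℝ≥0∞) :
    ∫⁻ ω, F ω ∂P = ∑' n, ∫⁻ ω in {ω | N ω = n}, F ω ∂P := by
  rw [← lintegral_iUnion (s := fun n => {ω | N ω = n}) (fun n => hN (measurableSet_singleton n))
    fun m n hmn => Set.disjoint_left.mpr fun ω hm hn => hmn (Eq.trans (Eq.symm hm) hn)]
  rw [Set.iUnion_eq_univ_iff.mpr fun ω => ⟨N ω, rfl⟩, Measure.restrict_univ]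

/-- Conditional independence is given on each event `N = n`; apply it there with the same test
function for every relay, then sum over `n`. -/
lemma IsRelayNetwork.lintegral_prod_linkFailure (hh : 0 ≤ h)
    (hnet : IsRelayNetwork S h P N X WU WR) (d : ℂ) :
    ∫⁻ ω, ∏ j ∈ Finset.range (N ω), S.linkFailure d (X j ω, WU j ω, WR j ω) ∂P =
      ∫⁻ ω, ∏ j ∈ Finset.range (N ω), S.linkOutage d (X j ω) ∂P := by
  have hN := hnet.poisson.measurable_N
  rw [lintegral_eq_tsum_fiber hN, lintegral_eq_tsum_fiber hN]
  refine tsum_congr fun n => ?_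
  have hn : MeasurableSet {ω | N ω = n} := hN (measurableSet_singleton n)
  have hfib : ∀ g : ℕ → Ω → ℝ≥0∞, ∫⁻ ω in {ω | N ω = n}, ∏ j ∈ Finset.range (N ω), g j ω ∂P =
      ∫⁻ ω in {ω | N ω = n}, ∏ j ∈ Finset.range n, g j ω ∂P := by
    intro g
    refine setLIntegral_congr_fun hn fun ω hω => ?_
    rw [Set.mem_ofPred_eq] at hω
    simp only [hω]
  rw [hfib fun j ω => S.linkFailure d (X j ω, WU j ω, WR j ω),
    hfib fun j ω => S.linkOutage d (X j ω),
    hnet.fading n (fun _ => S.linkFailure d) fun _ => S.measurable_linkFailure d]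
  simp_rw [S.lintegral_linkFailure hh d]

lemma allDecodeOutage_eq_integral_prod (hh : 0 ≤ h)
    (hnet : IsRelayNetwork S h P N X WU WR) (d : ℂ) :
    allDecodeOutage S d P N X WR =
      ∫ ω, ∏ j ∈ Finset.range (N ω), (S.linkOutage d (X j ω)).toReal ∂P := by
  have hN := hnet.poisson.measurable_N
  have hX := hnet.poisson.measurable_X
  -- The event is measurable because its indicator is a measurable product.
  have hE : MeasurableSet {ω | bestSNR S d X WR (Finset.range (N ω)) ω ≤ (S.xi : EReal)} := by
    have h1 := measurable_prod_range hN
      (g := fun j ω => S.linkFailure d (X j ω, WU j ω, WR j ω)) fun j =>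
      (S.measurable_linkFailure d).comp
        ((hX j).prodMk ((hnet.measurable_WU j).prodMk (hnet.measurable_WR j)))
    simp_rw [prod_linkFailure_eq_indicator] at h1
    exact (measurable_indicator_const_iff (1 : ℝ≥0∞)).mp h1
  simp_rw [← ENNReal.toReal_prod]
  have hq : Measurable fun ω => ∏ j ∈ Finset.range (N ω), S.linkOutage d (X j ω) :=
    measurable_prod_range hN fun j => (S.measurable_linkOutage d).comp (hX j)
  rw [integral_toReal hq.aemeasurable, allDecodeOutage, measureReal_def, ← lintegral_indicator_one hE,
    ← hnet.lintegral_prod_linkFailure hh]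
  · simp_rw [prod_linkFailure_eq_indicator]
  · refine Filter.Eventually.of_forall fun ω => lt_of_le_of_lt ?_ ENNReal.one_lt_top
    exact Finset.prod_le_one' fun j _ => S.linkOutage_le_one d _

lemma allDecodeOutage_eq [IsProbabilityMeasure P] (hh : 0 ≤ h)
    (hnet : IsRelayNetwork S h P N X WU WR) (rD φD : ℝ) :
    allDecodeOutage S (groundPoint rD φD) P N X WR =
      Real.exp (-(S.density * (S.psi01 - S.psi02 rD φD))) := by
  have hC : volume S.disk ≠ ∞ := measure_closedBall_lt_top.ne
  have : IsFiniteMeasure (volume.restrict S.disk) := ⟨by simpa using hC.lt_top⟩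
  have hq : Integrable (fun x => (S.linkOutage (groundPoint rD φD) x).toReal)
      (volume.restrict S.disk) := by
    refine Integrable.of_bound (C := 1)
      (S.measurable_linkOutage _).ennreal_toReal.aestronglyMeasurable
      (Filter.Eventually.of_forall fun x => ?_)
    rw [Real.norm_of_nonneg ENNReal.toReal_nonneg]
    exact ENNReal.toReal_one ▸ ENNReal.toReal_mono ENNReal.one_ne_top (S.linkOutage_le_one _ x)
  rw [allDecodeOutage_eq_integral_prod hh hnet, hnet.poisson.integral_prod S.density_nonneg hC
    (S.measurable_linkOutage _) (S.linkOutage_le_one _), integral_sub (integrable_const _) hq,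
    setIntegral_const, smul_eq_mul, mul_one, S.psi02_eq, System.psi01]

end UAVRelay

theorem mainTheorem2 {Ω : Type*} [MeasurableSpace Ω] (P : Measure Ω) [IsProbabilityMeasure P]
    (S : UAVRelay.System) (h rD φD : ℝ) (hh : 0 ≤ h) (hrD : 0 ≤ rD)
    (N : Ω → ℕ) (X : ℕ → Ω → ℂ) (WU WR : ℕ → Ω → ℝ)
    (hnet : UAVRelay.IsRelayNetwork S h P N X WU WR) :
    Real.exp (-(S.density * (S.psi01 - S.psi02 rD φD))) ≤
        UAVRelay.relayingOutage S h (UAVRelay.groundPoint rD φD) P N X WU WR ∧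
      UAVRelay.allDecodeOutage S (UAVRelay.groundPoint rD φD) P N X WR =
        Real.exp (-(S.density * (S.psi01 - S.psi02 rD φD))) := by
  have heq := UAVRelay.allDecodeOutage_eq hh hnet rD φD
  exact ⟨heq ▸ UAVRelay.allDecodeOutage_le_relayingOutage _, heq⟩
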